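/- Let $G$ be a graph. A distribution of pegs on $G$ is a set $D \subseteq V(G)$. A pegging move from $D$ takes distinct vertices $u, v \in D$ and a vertex $w \notin D$ such that $u$ and $w$ are both adjacent to $v$, and replaces $D$ by $(D \setminus \{u,v\}) \cup \{w\}$. A vertex $x$ is reachable from $D$ if some finite (possibly empty) sequence of pegging moves starting from $D$ leads to a distribution containing $x$. The optimal-pegging number $p(G)$ is the minimum size of a distribution on $G$ from which every vertex of $G$ is reachable. There exist infinitely many pairwise non-isomorphic finite trees $T$ that have a leaf $v$ (a vertex of degree $1$) such that $$p(T - v) > p(T),$$ where $T - v$ is the tree obtained from $T$ by deleting $v$. That is, the optimal-pegging number of $T$ strictly increases when the leaf $v$ is removed. -/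

import Mathlib

namespace Pegging

variable {V : Type*}

/-- A distribution of pegs on `G` is a set of vertices (the filled ones). There is a pegging move
from `D` to `D'` if a peg on `u` jumps over a peg on an adjacent vertex `v` onto an unfilled
vertex `w` adjacent to `v`, the peg on `v` being removed. -/
def Move (G : SimpleGraph V) (D D' : Set V) : Prop :=
  ∃ u v w : V, u ∈ D ∧ v ∈ D ∧ u ≠ v ∧ w ∉ D ∧ G.Adj u v ∧ G.Adj w v ∧
    D' = (D \ {u, v}) ∪ {w}

/-- The vertices which carry a peg after some finite (possibly empty) sequence of pegging moves
starting from `D`. -/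
def reach (G : SimpleGraph V) (D : Set V) : Set V :=
  {x | ∃ D' : Set V, Relation.ReflTransGen (Move G) D D' ∧ x ∈ D'}

/-- The minimum size of a distribution on `G` that can reach every vertex of `G`. -/
noncomputable def optimalPeggingNumber (G : SimpleGraph V) : ℕ∞ :=
  sInf {k | ∃ D : Set V, reach G D = Set.univ ∧ D.encard = k}

/-- A leaf: a vertex with exactly one neighbour. -/
def IsLeaf (G : SimpleGraph V) (v : V) : Prop :=
  ∃! w, G.Adj v w

/-- The graph obtained from `G` by deleting the vertex `v` and the edges at `v`. -/
abbrev removeVertex (G : SimpleGraph V) (v : V) : SimpleGraph ({v}ᶜ : Set V) :=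
  G.induce ({v}ᶜ : Set V)

end Pegging

/-! Let `B` be the perfect binary tree of height `24 + m`. Two bounds are played against each other.

Lower bound: give each vertex the weight `(2/3) ^ d`, where `d` is its distance to a target leaf
`x`. Since `1 ≤ 2/3 + 4/9`, no move increases the total weight, so reaching `x` needs total weight
at least `1`. With fewer than `2 ^ m` pegs, one of the `2 ^ m` subtrees of height `24` is empty.
Since `2 * (2/3) ^ 2 = 8/9 < 1`, all vertices outside it weigh less than `1` relative to one of its
leaves. Hence `p(B) ≥ 2 ^ m` (`two_pow_le_optimalPeggingNumber`).

Upper bound: attach `fib (m + 26)` paths of length two ("legs") to the root and fill them. Bringing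
a peg to depth `k` takes pegs at depths `k - 1` and `k - 2`, so the cost in legs obeys the Fibonacci
recursion (`yields_of_legs`), and `2 * fib (m + 26)` pegs suffice.

The golden ratio is below `2`, so for large `m` the larger tree has the smaller pegging number.
Stripping the legs leaf by leaf leads back to `B`, so some deletion must increase the number. Every
tree on the way contains `B`, hence such examples are arbitrarily large. -/

namespace Pegging

variable {V W : Type*}

/-! ### Moves: monotonicity and invariance under isomorphism -/

/-- `Yields G D E`: some sequence of pegging moves from `D` leads to a distribution containing
`E`. -/
def Yields (G : SimpleGraph V) (D E : Set V) : Prop :=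
  ∃ D' : Set V, Relation.ReflTransGen (Move G) D D' ∧ E ⊆ D'

theorem mem_reach_iff_yields {G : SimpleGraph V} {D : Set V} {x : V} :
    x ∈ reach G D ↔ Yields G D {x} := by
  simp [reach, Yields]

theorem Yields.of_subset {G : SimpleGraph V} {D E : Set V} (h : E ⊆ D) : Yields G D E :=
  ⟨D, .refl, h⟩

/-- Additional pegs never hurt: a move whose target is already occupied is simply skipped. -/
theorem exists_reflTransGen_superset {G : SimpleGraph V} {D E D' : Set V}
    (h : Relation.ReflTransGen (Move G) D E) (hD : D ⊆ D') :
    ∃ E', Relation.ReflTransGen (Move G) D' E' ∧ E ⊆ E' := by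
  induction h with
  | refl => exact ⟨D', .refl, hD⟩
  | tail _ hm ih =>
    obtain ⟨E', hE', hs⟩ := ih
    obtain ⟨u, v, w, hu, hv, huv, -, auv, awv, rfl⟩ := hm
    by_cases hw : w ∈ E'
    · refine ⟨E', hE', ?_⟩
      rintro y (hy | rfl)
      · exact hs hy.1
      · exact hw
    · exact ⟨_, hE'.tail ⟨u, v, w, hs hu, hs hv, huv, hw, auv, awv, rfl⟩, by gcongr⟩

theorem Yields.trans {G : SimpleGraph V} {D E F : Set V} (h₁ : Yields G D E)
    (h₂ : Yields G E F) : Yields G D F := by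
  obtain ⟨D', hD', hs⟩ := h₁
  obtain ⟨E', hE', ht⟩ := h₂
  obtain ⟨F', hF', hr⟩ := exists_reflTransGen_superset hE' hs
  exact ⟨F', hD'.trans hF', ht.trans hr⟩

theorem Yields.jump {G : SimpleGraph V} {F : Set V} {u v w : V} (huv : G.Adj u v)
    (hwv : G.Adj w v) (hu : u ∉ F) (hv : v ∉ F) : Yields G (insert u (insert v F)) (insert w F) := by
  by_cases hw : w ∈ insert u (insert v F)
  · refine .of_subset (Set.insert_subset hw ?_)
    exact (Set.subset_insert _ _).trans (Set.subset_insert _ _)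
  · refine ⟨_, .single ⟨u, v, w, by simp, by simp, huv.ne, hw, huv, hwv, rfl⟩, ?_⟩
    rintro y (rfl | hy)
    · simp
    · refine Or.inl ⟨by simp [hy], ?_⟩
      rintro (rfl | rfl)
      · exact hu hy
      · exact hv hy

theorem Move.image {G : SimpleGraph V} {H : SimpleGraph W} (e : G ≃g H) {D E : Set V}
    (h : Move G D E) : Move H (e '' D) (e '' E) := by
  obtain ⟨u, v, w, hu, hv, huv, hw, auv, awv, rfl⟩ := h
  refine ⟨e u, e v, e w, Set.mem_image_of_mem _ hu, Set.mem_image_of_mem _ hv,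
    e.injective.ne huv, ?_, e.map_adj_iff.2 auv, e.map_adj_iff.2 awv, ?_⟩
  · rwa [e.injective.mem_set_image]
  · rw [Set.image_union, Set.image_sdiff e.injective, Set.image_pair, Set.image_singleton]

theorem reach_image {G : SimpleGraph V} {H : SimpleGraph W} (e : G ≃g H) {D : Set V}
    (h : reach G D = Set.univ) : reach H (e '' D) = Set.univ := by
  refine Set.eq_univ_of_forall fun y => ?_
  obtain ⟨D', hD', hx⟩ : e.symm y ∈ reach G D := h ▸ Set.mem_univ _
  exact ⟨e '' D', hD'.lift (fun D => e '' D) fun _ _ => Move.image e, e.symm y, hx, by simp⟩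

theorem optimalPeggingNumber_le {G : SimpleGraph V} {D : Set V} (h : reach G D = Set.univ) :
    optimalPeggingNumber G ≤ D.encard :=
  sInf_le ⟨D, h, rfl⟩

theorem optimalPeggingNumber_le_of_iso {G : SimpleGraph V} {H : SimpleGraph W} (e : G ≃g H) :
    optimalPeggingNumber H ≤ optimalPeggingNumber G := by
  refine le_sInf ?_
  rintro k ⟨D, hD, rfl⟩
  exact (optimalPeggingNumber_le (reach_image e hD)).trans_eq (e.injective.encard_image D)

theorem optimalPeggingNumber_congr {G : SimpleGraph V} {H : SimpleGraph W} (e : G ≃g H) :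
    optimalPeggingNumber G = optimalPeggingNumber H :=
  (optimalPeggingNumber_le_of_iso e.symm).antisymm (optimalPeggingNumber_le_of_iso e)

/-! ### Weight functions and a criterion for trees -/

open Classical in
/-- The total weight of the pegs of a distribution. -/
noncomputable def totalWeight [Fintype V] (wt : V → ℚ) (D : Set V) : ℚ :=
  ∑ d, if d ∈ D then wt d else 0

theorem totalWeight_move_le [Fintype V] {G : SimpleGraph V} {wt : V → ℚ}
    (h : ∀ u v w, G.Adj u v → G.Adj w v → u ≠ w → wt w ≤ wt u + wt v) {D D' : Set V}
    (hm : Move G D D') : totalWeight wt D' ≤ totalWeight wt D := by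
  classical
  obtain ⟨u, v, w, hu, hv, huv, hw, auv, awv, rfl⟩ := hm
  have huw : u ≠ w := fun e => hw (e ▸ hu)
  have hvw : v ≠ w := fun e => hw (e ▸ hv)
  have key : ∑ d, ((if d = u then wt u else 0) + (if d = v then wt v else 0)
      - (if d = w then wt w else 0)) = wt u + wt v - wt w := by
    simp [Finset.sum_add_distrib, Finset.sum_sub_distrib]
  have hsum : totalWeight wt D - totalWeight wt ((D \ {u, v}) ∪ {w}) = wt u + wt v - wt w := by
    rw [← key, totalWeight, totalWeight, ← Finset.sum_sub_distrib]
    refine Finset.sum_congr rfl fun d _ => ?_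
    by_cases h1 : d = u
    · subst h1; simp [hu, huv, huw]
    by_cases h2 : d = v
    · subst h2; simp [hv, huv.symm, hvw]
    by_cases h3 : d = w
    · subst h3; simp [hw, h1, h2]
    simp [h1, h2, h3]
  linarith [h u v w auv awv huw]

theorem le_totalWeight_of_mem_reach [Fintype V] {G : SimpleGraph V} {wt : V → ℚ}
    (h0 : ∀ v, 0 ≤ wt v) (h : ∀ u v w, G.Adj u v → G.Adj w v → u ≠ w → wt w ≤ wt u + wt v)
    {D : Set V} {x : V} (hx : x ∈ reach G D) : wt x ≤ totalWeight wt D := by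
  classical
  obtain ⟨D', hD', hx⟩ := hx
  have h1 : totalWeight wt D' ≤ totalWeight wt D := by
    clear hx
    induction hD' with
    | refl => rfl
    | tail _ hm ih => exact (totalWeight_move_le h hm).trans ih
  refine le_trans ?_ h1
  have := Finset.single_le_sum (f := fun d => if d ∈ D' then wt d else 0)
    (fun d _ => by split_ifs <;> simp [h0]) (Finset.mem_univ x)
  simpa [hx, totalWeight] using this

/-- A graph with a rank function such that adjacent vertices have different ranks and every vertex
other than the root has exactly one neighbour of smaller rank is a tree. -/
theorem isTree_of_rank {G : SimpleGraph V} (ρ : V → ℕ) (r : V)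
    (hne : ∀ u v, G.Adj u v → ρ u ≠ ρ v)
    (hex : ∀ v, v ≠ r → ∃ u, G.Adj v u ∧ ρ u < ρ v)
    (huniq : ∀ v u w, G.Adj v u → G.Adj v w → ρ u < ρ v → ρ w < ρ v → u = w) : G.IsTree := by
  classical
  have hr : ∀ n v, ρ v = n → G.Reachable v r := by
    intro n
    induction n using Nat.strong_induction_on with
    | _ n ih =>
      rintro v rfl
      by_cases hv : v = r
      · exact hv ▸ .refl _
      · obtain ⟨u, hu, hlt⟩ := hex v hv
        exact hu.reachable.trans (ih _ hlt u rfl)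
  have : Nonempty V := ⟨r⟩
  refine ⟨⟨fun u v => (hr _ u rfl).trans (hr _ v rfl).symm⟩, fun v c hc => ?_⟩
  -- A vertex of maximal rank on a cycle has two distinct cycle neighbours, both of smaller rank.
  obtain ⟨m, hm, hmax⟩ := c.support.toFinset.exists_max_image ρ ⟨v, by simp⟩
  rw [List.mem_toFinset] at hm
  have hc' := hc.rotate hm
  have hle : ∀ y ∈ (c.rotate m hm).support, ρ y ≤ ρ m := fun y hy =>
    hmax y (by simpa using hy)
  have h1 := (c.rotate m hm).adj_snd hc'.not_nil
  have h2 := ((c.rotate m hm).adj_penultimate hc'.not_nil).symm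
  refine hc'.snd_ne_penultimate (huniq m _ _ h1 h2 ?_ ?_)
  · exact lt_of_le_of_ne (hle _ (SimpleGraph.Walk.getVert_mem_support _ _)) (hne _ _ h1).symm
  · exact lt_of_le_of_ne (hle _ (SimpleGraph.Walk.getVert_mem_support _ _)) (hne _ _ h2).symm

end Pegging

/-! ### The perfect binary tree and the lower bound -/

namespace Pegging

/-- The vertices of the perfect binary tree of height `n`, as descending paths from the root. -/
inductive BinTree : ℕ → Type
  | root (n : ℕ) : BinTree n
  | node {n : ℕ} (b : Bool) (x : BinTree n) : BinTree (n + 1)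

namespace BinTree

/-- A non-trivial perfect binary tree is a root and two perfect binary trees. -/
def equivOption (n : ℕ) : BinTree (n + 1) ≃ Option (Bool × BinTree n) where
  toFun
    | root _ => none
    | node b x => some (b, x)
  invFun
    | none => root _
    | some (b, x) => node b x
  left_inv x := by cases x <;> rfl
  right_inv x := by rcases x with _ | ⟨b, x⟩ <;> rfl

instance : Unique (BinTree 0) where
  default := root 0
  uniq x := by cases x; rfl

noncomputable instance fintype : (n : ℕ) → Fintype (BinTree n)
  | 0 => Unique.fintype
  | n + 1 => @Fintype.ofEquiv _ _ (@instFintypeOption _ (@instFintypeProd _ _ _ (fintype n)))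
      (equivOption n).symm

theorem sum_zero (f : BinTree 0 → ℚ) : ∑ x, f x = f (root 0) :=
  Fintype.sum_unique f

theorem sum_succ {n : ℕ} (f : BinTree (n + 1) → ℚ) :
    ∑ x, f x = f (root _) + ∑ x, f (node true x) + ∑ x, f (node false x) := by
  rw [← (equivOption n).symm.sum_comp, Fintype.sum_option, Fintype.sum_prod_type, Fintype.sum_bool,
    add_assoc]
  rfl

/-- The distance to the root. -/
def depth : {n : ℕ} → BinTree n → ℕ
  | _, root _ => 0
  | _, node _ x => depth x + 1

/-- The distance between two vertices. -/
def distance : {n : ℕ} → BinTree n → BinTree n → ℕ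
  | _, root _, y => depth y
  | _, node _ x, root _ => depth x + 1
  | _, node a x, node b y => if a = b then distance x y else depth x + depth y + 2

/-- `IsChild x y`: the vertex `y` is a child of `x`. -/
def IsChild : {n : ℕ} → BinTree n → BinTree n → Prop
  | _, root _, root _ => False
  | _, root _, node _ y => y = root _
  | _, node _ _, root _ => False
  | _, node a x, node b y => a = b ∧ IsChild x y

theorem IsChild.depth_eq {n : ℕ} {x y : BinTree n} (h : IsChild x y) : depth y = depth x + 1 := by
  induction x with
  | root n =>
    cases y with
    | root => simp [IsChild] at h
    | node b y => simp only [IsChild] at h; subst h; simp [depth]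
  | node a x ih =>
    cases y with
    | root => simp [IsChild] at h
    | node b y => simp [depth, ih h.2]

theorem IsChild.unique {n : ℕ} {x x' y : BinTree n} (h : IsChild x y) (h' : IsChild x' y) :
    x = x' := by
  induction y with
  | root n => cases x <;> simp [IsChild] at h
  | node b y ih =>
    cases x with
    | root =>
      cases x' with
      | root => rfl
      | node a' x' =>
        simp only [IsChild] at h h'
        subst h
        cases x' <;> simp [IsChild] at h'
    | node a x =>
      cases x' with
      | root =>
        simp only [IsChild] at h h'
        subst h'
        cases x <;> simp [IsChild] at h
      | node a' x' => rw [h.1, h'.1, ih h.2 h'.2]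

theorem exists_isChild {n : ℕ} {y : BinTree n} (h : y ≠ root n) : ∃ x, IsChild x y := by
  induction y with
  | root n => exact absurd rfl h
  | node b y ih =>
    by_cases hy : y = root _
    · exact ⟨root _, hy⟩
    · obtain ⟨x, hx⟩ := ih hy
      exact ⟨node b x, rfl, hx⟩

/-- The perfect binary tree of height `n`. -/
def graph (n : ℕ) : SimpleGraph (BinTree n) where
  Adj x y := IsChild x y ∨ IsChild y x
  symm := ⟨fun _ _ => Or.symm⟩
  loopless := ⟨fun x h => by
    have h : IsChild x x := h.elim id id
    have := h.depth_eq
    omega⟩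

theorem distance_self {n : ℕ} (x : BinTree n) : distance x x = 0 := by
  induction x with
  | root => simp [distance, depth]
  | node b x ih => simpa [distance] using ih

theorem distance_root {n : ℕ} (x : BinTree n) : distance x (root n) = depth x := by
  cases x <;> rfl

theorem IsChild.distance_eq {n : ℕ} (x : BinTree n) {u v : BinTree n} (h : IsChild u v) :
    distance x v = distance x u + 1 ∨ distance x u = distance x v + 1 := by
  induction x with
  | root n => exact Or.inl h.depth_eq
  | node a x ih =>
    cases v with
    | root => cases u <;> simp [IsChild] at h
    | node b v =>
      cases u with
      | root =>
        simp only [IsChild] at h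
        subst h
        by_cases hab : a = b <;> simp [distance, hab, distance_root, depth]
      | node c u =>
        obtain ⟨rfl, h⟩ := h
        by_cases hab : a = c
        · simpa [distance, hab] using ih h
        · have := h.depth_eq
          simp only [distance, if_neg hab]
          omega

theorem distance_eq_of_adj {n : ℕ} (x : BinTree n) {u v : BinTree n} (h : (graph n).Adj u v) :
    distance x v = distance x u + 1 ∨ distance x u = distance x v + 1 :=
  h.elim (fun h => h.distance_eq x) fun h => (h.distance_eq x).symm

theorem isChild_of_depth_lt {n : ℕ} {u v : BinTree n} (h : (graph n).Adj u v)
    (hlt : depth u < depth v) : IsChild u v := by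
  refine h.resolve_right fun h => ?_
  have := h.depth_eq
  omega

/-- In a tree, the only neighbour of `v` nearer to `x` is the next vertex on the path from `v` to
`x`. -/
theorem eq_of_distance_lt {n : ℕ} (x : BinTree n) {u v w : BinTree n} (hu : (graph n).Adj u v)
    (hw : (graph n).Adj w v) (hux : distance x u < distance x v)
    (hwx : distance x w < distance x v) : u = w := by
  induction x with
  | root n => exact (isChild_of_depth_lt hu hux).unique (isChild_of_depth_lt hw hwx)
  | @node n a x ih =>
    have hroot : ∀ {u : BinTree (n + 1)}, (graph _).Adj u (root _) →
        distance (node a x) u < distance (node a x) (root _) → u = node a (root _) := by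
      intro u h hlt
      rcases u with _ | ⟨b, u⟩
      · simp at h
      · obtain h | h := h
        · simp [IsChild] at h
        · simp only [IsChild] at h
          subst h
          by_cases hab : a = b
          · rw [hab]
          · simp only [distance, if_neg hab] at hlt
            omega
    cases v with
    | root => rw [hroot hu hux, hroot hw hwx]
    | node b v =>
      by_cases hab : a = b
      · subst hab
        have hnode : ∀ {u : BinTree (n + 1)}, (graph _).Adj u (node a v) →
            distance (node a x) u < distance (node a x) (node a v) →
            ∃ u', u = node a u' ∧ (graph n).Adj u' v ∧ distance x u' < distance x v := by
          intro u h hlt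
          rcases u with _ | ⟨b, u⟩
          · obtain h | h := h
            · simp only [IsChild] at h
              subst h
              simp [distance, distance_root] at hlt
            · simp [IsChild] at h
          · obtain ⟨rfl, h⟩ | ⟨rfl, h⟩ := h
            · exact ⟨u, rfl, Or.inl h, by simpa [distance] using hlt⟩
            · exact ⟨u, rfl, Or.inr h, by simpa [distance] using hlt⟩
        obtain ⟨u', rfl, hu', hux'⟩ := hnode hu hux
        obtain ⟨w', rfl, hw', hwx'⟩ := hnode hw hwx
        rw [ih hu' hw' hux' hwx']
      · have hparent : ∀ {u : BinTree (n + 1)}, (graph _).Adj u (node b v) →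
            distance (node a x) u < distance (node a x) (node b v) → IsChild u (node b v) := by
          intro u h hlt
          rcases u with _ | ⟨c, u⟩
          · obtain h | h := h
            · exact h
            · simp [IsChild] at h
          · obtain h | ⟨rfl, h⟩ := h
            · exact h
            · have := h.depth_eq
              simp only [distance, if_neg hab] at hlt
              omega
        exact (hparent hu hux).unique (hparent hw hwx)

/-- Of two neighbours of a vertex `v`, one is farther from `x` than `v` is. -/
theorem distance_neighbours {n : ℕ} (x : BinTree n) {u v w : BinTree n} (hu : (graph n).Adj u v)
    (hw : (graph n).Adj w v) (huw : u ≠ w) :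
    distance x w = distance x v + 1 ∨
      distance x u = distance x v + 1 ∧ distance x w + 1 = distance x v := by
  have := distance_eq_of_adj x hu
  have := distance_eq_of_adj x hw
  by_contra hcon
  exact huw (eq_of_distance_lt x hu hw (by omega) (by omega))

/-- The weight `(2 / 3) ^ d`, for `d` the distance to `x`. -/
def weight {n : ℕ} (x y : BinTree n) : ℚ := (2 / 3) ^ distance x y

/-- Either `w` is farther from `x` than `v`, and `v` alone outweighs it, or `u`, `v`, `w` approach
`x` in a line, and `1 ≤ 2/3 + 4/9` applies. -/
theorem weight_le {n : ℕ} (x : BinTree n) {u v w : BinTree n} (hu : (graph n).Adj u v)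
    (hw : (graph n).Adj w v) (huw : u ≠ w) : weight x w ≤ weight x u + weight x v := by
  have hv : (0 : ℚ) ≤ (2 / 3) ^ distance x v := by positivity
  have hu' : (0 : ℚ) ≤ (2 / 3) ^ distance x u := by positivity
  simp only [weight]
  rcases distance_neighbours x hu hw huw with h | ⟨h, h'⟩
  · rw [h, pow_succ]; linarith
  · have hw' : (0 : ℚ) ≤ (2 / 3) ^ distance x w := by positivity
    rw [h, ← h', pow_succ, pow_succ]; linarith

theorem sum_pow_depth (n : ℕ) : ∑ x : BinTree n, (2 / 3 : ℚ) ^ depth x = 4 * (4 / 3) ^ n - 3 := by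
  induction n with
  | zero => rw [sum_zero]; norm_num [depth]
  | succ n ih =>
    rw [sum_succ]
    simp only [depth, pow_succ, ← Finset.sum_mul, ih, pow_zero]
    ring

/-- The root and the sibling subtree are bounded as if completely filled; only the pegs in the
subtree of `x` are counted exactly. -/
theorem totalWeight_node_le {n : ℕ} (b : Bool) (x : BinTree n) (D : Set (BinTree (n + 1))) :
    totalWeight (weight (node b x)) D ≤ totalWeight (weight x) (node b ⁻¹' D) +
      (2 / 3) ^ (depth x + 1) + (2 / 3) ^ (depth x + 2) * (4 * (4 / 3) ^ n - 3) := by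
  classical
  have hroot : (if root (n + 1) ∈ D then weight (node b x) (root _) else 0) ≤
      (2 / 3) ^ (depth x + 1) := by
    split_ifs
    · simp [weight, distance]
    · positivity
  have hsame : ∑ y, (if node b y ∈ D then weight (node b x) (node b y) else 0) =
      totalWeight (weight x) (node b ⁻¹' D) := by
    simp [totalWeight, weight, distance]
  have hother : ∑ y, (if node (!b) y ∈ D then weight (node b x) (node (!b) y) else 0) ≤
      (2 / 3) ^ (depth x + 2) * (4 * (4 / 3) ^ n - 3) := by
    rw [← sum_pow_depth, Finset.mul_sum]
    refine Finset.sum_le_sum fun y _ => ?_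
    have : weight (node b x) (node (!b) y) = (2 / 3) ^ (depth x + 2) * (2 / 3) ^ depth y := by
      rw [← pow_add, weight, distance, if_neg (by cases b <;> simp)]
      congr 1; ring
    split_ifs
    · exact this.le
    · positivity
  rw [totalWeight, sum_succ]
  cases b <;> simp only [Bool.not_true, Bool.not_false] at hother <;> linarith

theorem encard_preimage_add_le {n : ℕ} (D : Set (BinTree (n + 1))) :
    (node true ⁻¹' D).encard + (node false ⁻¹' D).encard ≤ D.encard := by
  have hinj : ∀ b, Function.Injective (node (n := n) b) := fun b x y h => by cases h; rfl
  rw [← (hinj true).encard_image, ← (hinj false).encard_image, ← Set.encard_union_eq]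
  · refine Set.encard_le_encard ?_
    rintro y (⟨x, hx, rfl⟩ | ⟨x, hx, rfl⟩) <;> exact hx
  · rw [Set.disjoint_left]
    rintro y ⟨x, hx, rfl⟩ ⟨x', hx', h⟩
    cases h

/-- A distribution with fewer than `2 ^ m` pegs misses one of the `2 ^ m` subtrees of height `h`,
so its total weight relative to a leaf of that subtree is small. -/
theorem exists_totalWeight_le (h m : ℕ) (D : Set (BinTree (h + m))) (hD : D.encard < 2 ^ m) :
    ∃ x : BinTree (h + m), depth x = h + m ∧
      totalWeight (weight x) D ≤ 16 * ((8 / 9) ^ h - (8 / 9) ^ (h + m)) := by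
  induction m with
  | zero =>
    have : D = ∅ := by simpa using hD
    subst this
    have hx : ∀ n, ∃ x : BinTree n, depth x = n := by
      intro n
      induction n with
      | zero => exact ⟨root 0, rfl⟩
      | succ n ih =>
        obtain ⟨x, hx⟩ := ih
        exact ⟨node true x, by simp [depth, hx]⟩
    obtain ⟨x, hx⟩ := hx h
    exact ⟨x, hx, by simp [totalWeight]⟩
  | succ m ih =>
    -- One of the two halves receives fewer than half of the `2 ^ (m + 1)` pegs.
    obtain ⟨b, hb⟩ : ∃ b, (node b ⁻¹' D).encard < 2 ^ m := by
      by_contra! hcon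
      have := (add_le_add (hcon true) (hcon false)).trans (encard_preimage_add_le D)
      rw [← two_mul, ← pow_succ'] at this
      exact absurd hD this.not_gt
    obtain ⟨x, hx, hw⟩ := ih _ hb
    refine ⟨node b x, by simp only [depth, hx]; rfl, ?_⟩
    have key := totalWeight_node_le b x D
    rw [hx] at key
    refine key.trans ?_
    -- The bound grows by `(16/9) * (8/9) ^ (h + m)` in this step, which covers the root and the
    -- sibling subtree.
    have e1 : (8 / 9 : ℚ) ^ (h + m) = (2 / 3) ^ (h + m) * (4 / 3) ^ (h + m) := by
      rw [← mul_pow]; norm_num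
    have e2 : (0 : ℚ) ≤ (2 / 3) ^ (h + m) := by positivity
    rw [← add_assoc h m 1, pow_succ (8 / 9 : ℚ) (h + m)]
    rw [pow_succ (2 / 3 : ℚ) (h + m), pow_add (2 / 3 : ℚ) (h + m) 2]
    nlinarith

theorem two_pow_le_optimalPeggingNumber (m : ℕ) :
    2 ^ m ≤ optimalPeggingNumber (graph (24 + m)) := by
  refine le_sInf ?_
  rintro k ⟨D, hD, rfl⟩
  by_contra! hlt
  obtain ⟨x, -, hx⟩ := exists_totalWeight_le 24 m D hlt
  have hxD : x ∈ reach (graph (24 + m)) D := hD ▸ Set.mem_univ x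
  have h1 := le_totalWeight_of_mem_reach (wt := weight x) (fun v => by unfold weight; positivity)
    (fun u v w hu hw huw => weight_le x hu hw huw) hxD
  have h2 : (0 : ℚ) ≤ (8 / 9) ^ (24 + m) := by positivity
  rw [weight, distance_self, pow_zero] at h1
  -- This inequality dictates the height `24` of the empty subtree.
  have h3 : 16 * (8 / 9 : ℚ) ^ 24 < 1 := by norm_num
  linarith

end BinTree

end Pegging

/-! ### Attached legs and the upper bound -/

namespace Pegging

namespace BinTree

theorem depth_le {n : ℕ} (x : BinTree n) : depth x ≤ n := by
  induction x with
  | root => simp [depth]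
  | node b x ih => simpa [depth] using ih

theorem eq_root_of_depth_eq_zero {n : ℕ} {x : BinTree n} (h : depth x = 0) : x = root n := by
  cases x with
  | root => rfl
  | node => simp [depth] at h

theorem exists_isChild_of_depth_eq {n k : ℕ} {y : BinTree n} (h : depth y = k + 1) :
    ∃ x, IsChild x y ∧ depth x = k := by
  obtain ⟨x, hx⟩ := exists_isChild (y := y) (by rintro rfl; simp [depth] at h)
  exact ⟨x, hx, by have := hx.depth_eq; omega⟩

section Spend

variable {n : ℕ} {W ι : Type*} {H : SimpleGraph W} {t : BinTree n → W} {leg : ι → Bool → W}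

/-- Paths of length two attached to the root, both of whose vertices carry pegs, can be spent to
bring a peg to a vertex of depth `k` while keeping all pegs below it: `fib (k + 2)` such paths
suffice. -/
theorem yields_of_legs [DecidableEq ι] (ht : Function.Injective t)
    (hleg : Function.Injective fun p : ι × Bool => leg p.1 p.2) (htl : ∀ x i b, t x ≠ leg i b)
    (hchild : ∀ x y, IsChild x y → H.Adj (t x) (t y))
    (hin : ∀ i, H.Adj (t (root n)) (leg i false)) (hout : ∀ i, H.Adj (leg i true) (leg i false))
    (k : ℕ) (y : BinTree n) (hy : depth y = k) (I : Finset ι) (hI : I.card = Nat.fib (k + 2))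
    (F : Set W) (hF : ∀ i ∈ I, ∀ b, leg i b ∉ F) (hFt : ∀ x, t x ∈ F → k < depth x) :
    Yields H ({p | ∃ i ∈ I, ∃ b, p = leg i b} ∪ F) (insert (t y) F) := by
  have hleg' : ∀ {i j a b}, leg i a = leg j b → i = j ∧ a = b := fun {i j a b} h => by
    simpa using hleg (a₁ := (i, a)) (a₂ := (j, b)) h
  have hroot : ∀ (i : ι) (F : Set W), (∀ b, leg i b ∉ F) →
      Yields H ({p | ∃ b, p = leg i b} ∪ F) (insert (t (root n)) F) := by
    intro i F hF
    refine .trans (.of_subset ?_) (.jump (hout i) (hin i) (hF true) (hF false))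
    rintro p (rfl | rfl | hp)
    · exact Or.inl ⟨_, rfl⟩
    · exact Or.inl ⟨_, rfl⟩
    · exact Or.inr hp
  induction k using Nat.twoStepInduction generalizing y I F with
  | zero =>
    obtain ⟨i, rfl⟩ := Finset.card_eq_one.1 hI
    rw [eq_root_of_depth_eq_zero hy]
    simpa using hroot i F (hF i (by simp))
  | one =>
    obtain ⟨i, j, hij, rfl⟩ := Finset.card_eq_two.1 (hI.trans (by decide))
    obtain ⟨x, hx, hx0⟩ := exists_isChild_of_depth_eq hy
    obtain rfl := eq_root_of_depth_eq_zero hx0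
    have h1 := hroot i (insert (leg j false) F) (by
      rintro b (h | h)
      · exact hij (hleg' h).1
      · exact hF i (by simp) b h)
    -- The inner peg of the second leg jumps over the root onto its child.
    have h2 : Yields H (insert (leg j false) (insert (t (root n)) F)) (insert (t y) F) :=
      .jump (hin j).symm (hchild _ _ hx).symm (hF j (by simp) _)
        fun h => by simpa [depth] using hFt _ h
    rw [Set.insert_comm] at h2
    refine .trans (.of_subset ?_) (h1.trans h2)
    rintro p (⟨b, rfl⟩ | rfl | hp)
    · exact Or.inl ⟨i, by simp, b, rfl⟩
    · exact Or.inl ⟨j, by simp, _, rfl⟩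
    · exact Or.inr hp
  | more k ih₀ ih₁ =>
    obtain ⟨z, hz, hz'⟩ := exists_isChild_of_depth_eq hy
    obtain ⟨x, hx, hx'⟩ := exists_isChild_of_depth_eq hz'
    have hfib : Nat.fib (k + 2 + 2) = Nat.fib (k + 2) + Nat.fib (k + 1 + 2) := Nat.fib_add_two
    obtain ⟨J, hJI, hJ⟩ := Finset.exists_subset_card_eq (s := I) (n := Nat.fib (k + 1 + 2))
      (by omega)
    have hJc : (I \ J).card = Nat.fib (k + 2) := by
      rw [Finset.card_sdiff_of_subset hJI]; omega
    -- The parent `z` is filled first, with the legs outside `J` kept in reserve. Its peg then lies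
    -- deeper than the grandparent `x`, so it survives while `x` is filled; finally `x` jumps over
    -- `z` onto `y`.
    have h1 := ih₁ z hz' J hJ ({p | ∃ i ∈ I \ J, ∃ b, p = leg i b} ∪ F) (by
      rintro i hi b (⟨j, hj, a, h⟩ | h)
      · obtain ⟨rfl, -⟩ := hleg' h
        exact (Finset.mem_sdiff.1 hj).2 hi
      · exact hF i (hJI hi) b h) (by
      rintro w (⟨j, hj, a, h⟩ | h)
      · exact absurd h (htl _ _ _)
      · have := hFt w h
        omega)
    have h2 := ih₀ x hx' (I \ J) hJc (insert (t z) F) (by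
      rintro i hi b (h | h)
      · exact htl _ _ _ h.symm
      · exact hF i (Finset.mem_sdiff.1 hi).1 b h) (by
      rintro w (h | h)
      · rw [ht h]
        omega
      · have := hFt w h
        omega)
    have h3 : Yields H (insert (t x) (insert (t z) F)) (insert (t y) F) :=
      .jump (hchild _ _ hx) (hchild _ _ hz).symm (fun h => by have := hFt _ h; omega)
        fun h => by have := hFt _ h; omega
    refine .trans (.of_subset ?_) (h1.trans (.trans (.of_subset ?_) (h2.trans h3)))
    · rintro p (⟨i, hi, b, rfl⟩ | ⟨i, hi, b, rfl⟩ | hp)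
      · exact Or.inl ⟨i, hJI hi, b, rfl⟩
      · exact Or.inl ⟨i, (Finset.mem_sdiff.1 hi).1, b, rfl⟩
      · exact Or.inr hp
    · rintro p (hp | rfl | hp)
      · exact Or.inr (Or.inl hp)
      · exact Or.inl rfl
      · exact Or.inr (Or.inr hp)

end Spend

/-- The perfect binary tree of height `n` with infinitely many paths of length two attached to its
root; `Sum.inr (i, false)` is the inner and `Sum.inr (i, true)` the outer vertex of a path. -/
def legged (n : ℕ) : SimpleGraph (BinTree n ⊕ ℕ × Bool) where
  Adj
    | .inl x, .inl y => (graph n).Adj x y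
    | .inl x, .inr p => x = root n ∧ p.2 = false
    | .inr p, .inl x => x = root n ∧ p.2 = false
    | .inr p, .inr q => p.1 = q.1 ∧ p.2 ≠ q.2
  symm := ⟨by
    rintro (x | p) (y | q) h
    · exact SimpleGraph.Adj.symm (G := graph n) h
    · exact h
    · exact h
    · exact ⟨h.1.symm, h.2.symm⟩⟩
  loopless := ⟨by
    rintro (x | p) h
    · exact (graph n).loopless.irrefl x h
    · exact h.2 rfl⟩

/-- The distance to the root in `legged n`. -/
def leggedDepth {n : ℕ} : BinTree n ⊕ ℕ × Bool → ℕ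
  | .inl x => depth x
  | .inr (_, false) => 1
  | .inr (_, true) => 2

theorem isTree_induce_legged {n : ℕ} {S : Set (BinTree n ⊕ ℕ × Bool)}
    (hS : ∀ x, Sum.inl x ∈ S) (hS' : ∀ i, Sum.inr (i, true) ∈ S → Sum.inr (i, false) ∈ S) :
    ((legged n).induce S).IsTree := by
  refine isTree_of_rank (fun p => leggedDepth p.1) ⟨.inl (root n), hS _⟩ ?_ ?_ ?_
  · rintro ⟨x | ⟨i, _ | _⟩, hx⟩ ⟨y | ⟨j, _ | _⟩, hy⟩ h <;>
      simp [legged, leggedDepth] at h ⊢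
    · obtain h | h := h <;> have := h.depth_eq <;> omega
    all_goals simp [h, depth]
  · rintro ⟨x | ⟨i, _ | _⟩, hx⟩ h
    · obtain ⟨y, hy⟩ := exists_isChild (y := x) (by rintro rfl; exact h rfl)
      exact ⟨⟨.inl y, hS y⟩, Or.inr hy, by simp [leggedDepth, hy.depth_eq]⟩
    · exact ⟨⟨.inl (root n), hS _⟩, ⟨rfl, rfl⟩, by simp [leggedDepth, depth]⟩
    · exact ⟨⟨.inr (i, false), hS' i hx⟩, ⟨rfl, by simp⟩, by simp [leggedDepth]⟩
  · rintro ⟨x | ⟨i, _ | _⟩, hx⟩ ⟨y | ⟨j, _ | _⟩, hy⟩ ⟨z | ⟨k, _ | _⟩, hz⟩ h h' hlt hlt' <;>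
      simp [legged, leggedDepth] at h h' hlt hlt' ⊢
    · exact (isChild_of_depth_lt h.symm hlt).unique (isChild_of_depth_lt h'.symm hlt')
    all_goals first | omega | exact h.trans h'.symm |
      (subst h; simp [depth] at hlt) | (subst h'; simp [depth] at hlt')

/-- The perfect binary tree together with the first `N` attached paths. -/
def leggedSet (n N : ℕ) : Set (BinTree n ⊕ ℕ × Bool) :=
  {p | ∀ q, p = .inr q → q.1 < N}

/-- All legs are filled and the binary tree is left empty; no vertex is deeper than `n`, so the
supply of legs suffices for each target. -/
theorem optimalPeggingNumber_leggedSet_le (n : ℕ) :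
    optimalPeggingNumber ((legged n).induce (leggedSet n (Nat.fib (n + 2)))) ≤
      2 * Nat.fib (n + 2) := by
  set N := Nat.fib (n + 2) with hN
  let leg : Fin N → Bool → leggedSet n N := fun i b => ⟨.inr (i, b), by
    rintro q h; cases h; exact i.2⟩
  let t : BinTree n → leggedSet n N := fun x => ⟨.inl x, fun q h => by cases h⟩
  have hleg : Function.Injective fun p : Fin N × Bool => leg p.1 p.2 := by
    rintro ⟨i, a⟩ ⟨j, b⟩ h
    simpa [leg, Fin.ext_iff] using congrArg Subtype.val h
  have hreach : reach ((legged n).induce (leggedSet n N))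
      (Set.range fun p : Fin N × Bool => leg p.1 p.2) = Set.univ := by
    refine Set.eq_univ_of_forall fun y => ?_
    rw [mem_reach_iff_yields]
    obtain ⟨y | ⟨i, b⟩, hy⟩ := y
    · obtain ⟨I, -, hI⟩ := Finset.exists_subset_card_eq (s := (Finset.univ : Finset (Fin N)))
        (n := Nat.fib (depth y + 2))
        (by rw [Finset.card_fin]; exact Nat.fib_mono (by have := depth_le y; omega))
      have := yields_of_legs (H := (legged n).induce (leggedSet n N)) (t := t) (leg := leg)
        (fun x y h => by simpa [t] using congrArg Subtype.val h) hleg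
        (fun x i b h => by simpa [t, leg] using congrArg Subtype.val h)
        (fun x y h => Or.inl h) (fun i => ⟨rfl, rfl⟩) (fun i => ⟨rfl, by simp⟩) _ y rfl I hI ∅
        (by simp) (by simp)
      refine .trans (.of_subset ?_) (this.trans (.of_subset (by simp [t])))
      rintro p (⟨i, -, b, rfl⟩ | hp)
      · exact ⟨(i, b), rfl⟩
      · exact hp.elim
    · refine .of_subset (Set.singleton_subset_iff.2 ?_)
      exact ⟨(⟨i, hy _ rfl⟩, b), rfl⟩
  refine (optimalPeggingNumber_le hreach).trans_eq ?_
  rw [← Set.image_univ, hleg.encard_image, Set.encard_univ]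
  simp [mul_comm]

end BinTree

end Pegging

/-! ### Stripping the legs leaf by leaf -/

namespace Pegging

variable {V W : Type*}

/-- Isomorphic graphs remain isomorphic after removing corresponding vertices. -/
def removeVertexIso {G : SimpleGraph V} {H : SimpleGraph W} (e : G ≃g H) (v : V) :
    removeVertex G v ≃g removeVertex H (e v) where
  toEquiv := e.toEquiv.subtypeEquiv fun x => by simp
  map_rel_iff' {x y} := e.map_adj_iff (v := x.1) (w := y.1)

/-- Adding a vertex to an induced subgraph and removing it again changes nothing. -/
def removeVertexInduceInsertIso (H : SimpleGraph V) {S : Set V} {v : V} (hv : v ∉ S) :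
    removeVertex (H.induce (insert v S)) ⟨v, Set.mem_insert v S⟩ ≃g H.induce S where
  toFun x := ⟨x.1.1, x.1.2.resolve_left fun h => x.2 (Subtype.ext h)⟩
  invFun x := ⟨⟨x.1, Set.mem_insert_of_mem v x.2⟩, fun h => hv <| by
    have h : x.1 = v := congrArg Subtype.val h
    exact h ▸ x.2⟩
  left_inv _ := rfl
  right_inv _ := rfl
  map_rel_iff' := Iff.rfl

theorem IsLeaf.map {G : SimpleGraph V} {H : SimpleGraph W} (e : G ≃g H) {v : V}
    (h : IsLeaf G v) : IsLeaf H (e v) := by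
  obtain ⟨w, hw, hu⟩ := h
  refine ⟨e w, e.map_adj_iff.2 hw, fun y hy => ?_⟩
  rw [← hu (e.symm y) (e.map_adj_iff.1 (by simpa using hy))]
  simp

/-- If, among trees with at least `K` vertices, removing a leaf never increases the
optimal-pegging number, then the same holds for trees on any finite vertex type. -/
theorem optimalPeggingNumber_removeVertex_le_of_fin {K : ℕ}
    (h : ∀ m, K ≤ m → ∀ (T : SimpleGraph (Fin m)) (v : Fin m), T.IsTree → IsLeaf T v →
      optimalPeggingNumber (removeVertex T v) ≤ optimalPeggingNumber T)
    [Finite V] {G : SimpleGraph V} {v : V} (hK : K ≤ Nat.card V) (hG : G.IsTree)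
    (hv : IsLeaf G v) : optimalPeggingNumber (removeVertex G v) ≤ optimalPeggingNumber G := by
  let e := SimpleGraph.Iso.map (Finite.equivFin V) G
  rw [optimalPeggingNumber_congr (removeVertexIso e v), optimalPeggingNumber_congr e]
  exact h _ hK _ _ (e.isTree_iff.1 hG) (hv.map e)

namespace BinTree

theorem leggedSet_zero (n : ℕ) : leggedSet n 0 = Set.range Sum.inl := by
  ext (x | p)
  · simp [leggedSet]
  · simpa using fun h : _ ∈ leggedSet n 0 => Nat.not_lt_zero _ (h p rfl)

theorem leggedSet_succ (n N : ℕ) : leggedSet n (N + 1) =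
    insert (.inr (N, true)) (insert (.inr (N, false)) (leggedSet n N)) := by
  ext (x | ⟨i, _ | _⟩) <;> simp [leggedSet] <;> omega

/-- The perfect binary tree inside the tree with paths attached. -/
noncomputable def graphIso (n : ℕ) : graph n ≃g (legged n).induce (leggedSet n 0) where
  toEquiv := (Equiv.ofInjective _ Sum.inl_injective).trans (Equiv.setCongr (leggedSet_zero n).symm)
  map_rel_iff' := Iff.rfl

instance (n N : ℕ) : Finite (leggedSet n N) := by
  induction N with
  | zero => rw [leggedSet_zero]; infer_instance
  | succ N ih => rw [leggedSet_succ]; infer_instance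

theorem le_natCard (n : ℕ) : n ≤ Nat.card (BinTree n) := by
  induction n with
  | zero => simp
  | succ n ih =>
    rw [Nat.card_congr (equivOption n), Finite.card_option, Nat.card_prod, Nat.card_eq_fintype_card,
      Fintype.card_bool]
    omega

theorem le_natCard_of_forall_inl_mem {n : ℕ} {S : Set (BinTree n ⊕ ℕ × Bool)} [Finite S]
    (hS : ∀ x, Sum.inl x ∈ S) : n ≤ Nat.card S := by
  have hinj : Function.Injective fun x : BinTree n => (⟨.inl x, hS x⟩ : S) := fun x y h => by
    simpa using congrArg Subtype.val h
  exact (le_natCard n).trans (Nat.card_le_card_of_injective _ hinj)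

/-- Each leg is stripped by two leaf deletions, the outer vertex and then the inner one. The binary
tree is never touched, so the trees retain at least `n ≥ K` vertices and `h` applies throughout. -/
theorem optimalPeggingNumber_graph_le {K n : ℕ} (hK : K ≤ n)
    (h : ∀ m, K ≤ m → ∀ (T : SimpleGraph (Fin m)) (v : Fin m), T.IsTree → IsLeaf T v →
      optimalPeggingNumber (removeVertex T v) ≤ optimalPeggingNumber T) (N : ℕ) :
    optimalPeggingNumber (graph n) ≤
      optimalPeggingNumber ((legged n).induce (leggedSet n N)) := by
  induction N with
  | zero => exact (optimalPeggingNumber_congr (graphIso n)).le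
  | succ N ih =>
    have hinl : ∀ x, Sum.inl x ∈ leggedSet n N := fun x q h => by cases h
    have hlt : ∀ {i b}, Sum.inr (i, b) ∈ leggedSet n N → i < N := fun h => h _ rfl
    have h1 : Sum.inr (N, false) ∉ leggedSet n N := fun h => (hlt h).false
    have h2 : Sum.inr (N, true) ∉ insert (Sum.inr (N, false)) (leggedSet n N) := by
      rintro (h | h)
      · simp at h
      · exact (hlt h).false
    have hmem : ∀ i, Sum.inr (i, true) ∈ leggedSet n N → Sum.inr (i, false) ∈ leggedSet n N := by
      rintro i hi q ⟨⟩
      exact hlt hi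
    rw [leggedSet_succ]
    refine ih.trans ?_
    rw [← optimalPeggingNumber_congr (removeVertexInduceInsertIso (legged n) h1)]
    refine (optimalPeggingNumber_removeVertex_le_of_fin h ?_ ?_ ?_).trans ?_
    · exact hK.trans (le_natCard_of_forall_inl_mem fun x => Or.inr (hinl x))
    · refine isTree_induce_legged (fun x => Or.inr (hinl x)) fun i hi => ?_
      obtain hi | hi := hi
      · simp at hi
      · exact Or.inr (hmem i hi)
    · refine ⟨⟨.inl (root n), Or.inr (hinl _)⟩, ⟨rfl, rfl⟩, ?_⟩
      rintro ⟨x | ⟨i, b⟩, hx⟩ hadj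
      · exact Subtype.ext (congrArg Sum.inl hadj.1)
      · obtain ⟨rfl, hb⟩ : N = i ∧ false ≠ b := hadj
        obtain hx | hx := hx
        · simp at hx
          exact absurd hx.symm hb
        · exact absurd (hlt hx) (lt_irrefl _)
    rw [← optimalPeggingNumber_congr (removeVertexInduceInsertIso (legged n) h2)]
    refine optimalPeggingNumber_removeVertex_le_of_fin h ?_ ?_ ?_
    · exact hK.trans (le_natCard_of_forall_inl_mem fun x => Or.inr (Or.inr (hinl x)))
    · refine isTree_induce_legged (fun x => Or.inr (Or.inr (hinl x))) fun i hi => ?_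
      obtain hi | hi | hi := hi
      · obtain rfl : i = N := by simpa using hi
        exact Or.inr (Or.inl rfl)
      · simp at hi
      · exact Or.inr (Or.inr (hmem i hi))
    · refine ⟨⟨.inr (N, false), Or.inr (Or.inl rfl)⟩, ⟨rfl, by simp⟩, ?_⟩
      rintro ⟨x | ⟨i, b⟩, hx⟩ hadj
      · exact absurd hadj.2 (by simp)
      · obtain ⟨rfl, hb⟩ : N = i ∧ true ≠ b := hadj
        cases b
        · rfl
        · exact absurd rfl hb

end BinTree

/-- The left side at most doubles at each step, so only a valid starting point such as `60` is
needed. -/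
theorem two_mul_fib_lt_two_pow {m : ℕ} (hm : 60 ≤ m) : 2 * Nat.fib (24 + m + 2) < 2 ^ m := by
  induction m, hm using Nat.le_induction with
  | base => norm_num
  | succ m _ ih =>
    have h1 : Nat.fib (24 + (m + 1) + 2) = Nat.fib (24 + m + 1) + Nat.fib (24 + m + 2) :=
      Nat.fib_add_two
    have h2 : Nat.fib (24 + m + 1) ≤ Nat.fib (24 + m + 2) := Nat.fib_mono (by omega)
    rw [pow_succ]
    omega

/-- There are arbitrarily large trees with a leaf whose removal increases the optimal-pegging
number. -/
theorem exists_isTree_optimalPeggingNumber_lt (K : ℕ) :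
    ∃ m, K ≤ m ∧ ∃ (T : SimpleGraph (Fin m)) (v : Fin m), T.IsTree ∧ IsLeaf T v ∧
      optimalPeggingNumber T < optimalPeggingNumber (removeVertex T v) := by
  by_contra! hcon
  have h1 := BinTree.two_pow_le_optimalPeggingNumber (60 + K)
  have h2 := BinTree.optimalPeggingNumber_graph_le (n := 24 + (60 + K)) (by omega) hcon
    (Nat.fib (24 + (60 + K) + 2))
  have h3 := BinTree.optimalPeggingNumber_leggedSet_le (24 + (60 + K))
  have h4 := (h1.trans h2).trans h3
  exact (two_mul_fib_lt_two_pow (m := 60 + K) (by omega)).not_ge (by exact_mod_cast h4)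

end Pegging

/-- There is an infinite sequence of pairwise non-isomorphic finite trees, each of which has a leaf
whose removal strictly increases the optimal-pegging number. -/
theorem corollary5p3 :
    ∃ (n : ℕ → ℕ) (T : (i : ℕ) → SimpleGraph (Fin (n i))),
      (∀ i j : ℕ, i ≠ j → IsEmpty (T i ≃g T j)) ∧
      ∀ i : ℕ, (T i).IsTree ∧
        ∃ v : Fin (n i), Pegging.IsLeaf (T i) v ∧
          Pegging.optimalPeggingNumber (T i) <
            Pegging.optimalPeggingNumber (Pegging.removeVertex (T i) v) := by
  choose f hf T v hT hv hlt using Pegging.exists_isTree_optimalPeggingNumber_lt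
  -- Each size bound exceeds the order of the preceding tree, so the orders strictly increase and
  -- rule out isomorphisms.
  let k : ℕ → ℕ := fun i => (fun m => f m + 1)^[i] 0
  have hmono : StrictMono fun i => f (k i) := strictMono_nat_of_lt_succ fun i => by
    have h : k (i + 1) = f (k i) + 1 := Function.iterate_succ_apply' _ _ _
    have := hf (k (i + 1))
    omega
  refine ⟨fun i => f (k i), fun i => T (k i), fun i j hij => ⟨fun e => hij ?_⟩,
    fun i => ⟨hT _, v _, hv _, hlt _⟩⟩
  exact hmono.injective (by simpa using Fintype.card_congr e.toEquiv)
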